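/- For a real symmetric matrix $A=\sum_j \lambda_j v_jv_j^\top$ (orthonormal eigendecomposition) write $|A|:=\sum_j|\lambda_j|\,v_jv_j^\top$; write $A\preceq B$ if $B-A$ is positive semidefinite; $\|\cdot\|_{\mathrm{op}}$ is the operator norm (largest singular value), $B_2^m$ the closed Euclidean unit ball of $\mathbb{R}^m$, $d(y,S)$ the Euclidean distance from $y$ to $S$, and $\gamma_m$ the standard Gaussian measure $N(0,I_m)$ on $\mathbb{R}^m$. Let $A_1,\dots,A_m\in\mathbb{R}^{n\times n}$ be symmetric matrices with $\sum_{i=1}^m |A_i|\preceq I_n$, and let $\varepsilon\in(0,1)$ be such that $m=\frac{n}{\varepsilon^2}\ge 100$. Let $$K:=\Big\{x\in\mathbb{R}^m : \Big\|\sum_{i=1}^m x_iA_i\Big\|_{\mathrm{op}}\le\varepsilon\Big\}.$$ Then for every $0<\alpha<1$, $$\gamma_m\Big(\tfrac{50}{\alpha}K+\alpha\sqrt{m}\,B_2^m\Big)\ge\tfrac12,$$ where $+$ is the Minkowski sum. That is, $\Pr_{y\sim N(0,I_m)}\big[d\big(y,\tfrac{50}{\alpha}K\big)\le\alpha\sqrt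 m\big]\ge\tfrac12$. -/

import Mathlib

open scoped MatrixOrder Pointwise

namespace SpectralGaussian

/-- `|A|` for a real symmetric matrix `A = ∑ λᵢ vᵢ vᵢᵀ`: the matrix `∑ |λᵢ| vᵢ vᵢᵀ`, obtained by
replacing every eigenvalue in an orthonormal eigendecomposition by its absolute value. -/
noncomputable def matAbs {n : ℕ} {A : Matrix (Fin n) (Fin n) ℝ} (hA : A.IsHermitian) :
    Matrix (Fin n) (Fin n) ℝ :=
  hA.cfc (fun t : ℝ => |t|)

/-- The operator norm of a square matrix with respect to the Euclidean norm. -/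
noncomputable def matOpNorm {n : ℕ} (M : Matrix (Fin n) (Fin n) ℝ) : ℝ :=
  ‖Matrix.toEuclideanCLM (n := Fin n) (𝕜 := ℝ) M‖

/-- The linear combination `∑ xᵢ Aᵢ`. -/
def matComb {m n : ℕ} (A : Fin m → Matrix (Fin n) (Fin n) ℝ) (x : Fin m → ℝ) :
    Matrix (Fin n) (Fin n) ℝ :=
  ∑ i, x i • A i

/-- The body `K = {x ∈ ℝᵐ : ‖∑ xᵢ Aᵢ‖_op ≤ ε}`. -/
def body {m n : ℕ} (A : Fin m → Matrix (Fin n) (Fin n) ℝ) (ε : ℝ) :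
    Set (EuclideanSpace ℝ (Fin m)) :=
  {x | matOpNorm (matComb A x) ≤ ε}

end SpectralGaussian

/-! The idea is to move a Gaussian point `y` into the body by a proximal map and bound the mean
squared displacement. Let `𝒜 x` be the block matrix with diagonal blocks `∑ xᵢ Aᵢ` and `-∑ xᵢ Aᵢ`,
of size `N = 2n`, and let `Ψ(x) = -μ log det (c I - 𝒜 x)` with `c = s ε`. Let `p(y)` solve `p +
∇Ψ(p) = y`; then `c I - 𝒜 p(y)` is positive definite, so `p(y)` lies in `s K`.

Put `G(y) = y - p(y) = ∇Ψ(p(y))` and `R = (c I - 𝒜 p(y))⁻¹`. Then `‖G‖² = ⟪y, G⟫ - ⟪p, G⟫`. By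
Stein's identity (`integral_inner_mul_stdGaussian`) the first term has the mean of `tr DG`. With `J`
the Hessian of `Ψ` at `p(y)`, `DG = J (1 + J)⁻¹`, whose `i`-th diagonal entry is at most `√(Jᵢᵢ) /
2` (`inner_apply_le_half`). Moreover `Jᵢᵢ = μ tr (R 𝒜ᵢ R 𝒜ᵢ) ≤ μ (tr R |𝒜ᵢ|)²`
(`trace_mul_mul_mul_le_sq`), so `∑ |Aᵢ| ⪯ I` gives `tr DG ≤ √μ tr R / 2`. The second term is exactly
`μ (c tr R - N)` (`inner_barrierGrad_self`).

For `μ = 1 / (4 c²)` the multiples of `tr R` cancel and `E ‖G‖² ≤ N / (4 c²) = n / (2 c²)`. Markov's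
inequality finishes. -/

namespace SpectralGaussian

open MeasureTheory ProbabilityTheory Module
open scoped RealInnerProductSpace ENNReal

/-! ### Gaussian integration by parts. -/

section Stein

variable {E : Type*} [NormedAddCommGroup E] [InnerProductSpace ℝ E]

/-- The Lebesgue density of the standard Gaussian measure. -/
noncomputable def gaussianDensity (E : Type*) [NormedAddCommGroup E] [InnerProductSpace ℝ E]
    (x : E) : ℝ :=
  ((2 * Real.pi) ^ ((finrank ℝ E : ℝ) / 2))⁻¹ * Real.exp (-(1 / 2) * ‖x‖ ^ 2)

lemma gaussianDensity_nonneg (x : E) : 0 ≤ gaussianDensity E x := by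
  unfold gaussianDensity; positivity

lemma continuous_gaussianDensity : Continuous (gaussianDensity E) := by
  unfold gaussianDensity; fun_prop

lemma hasFDerivAt_gaussianDensity (x : E) :
    HasFDerivAt (gaussianDensity E) (-(gaussianDensity E x) • innerSL ℝ x) x := by
  have h1 : HasFDerivAt (fun x : E => -(1 / 2) * ‖x‖ ^ 2) (-innerSL ℝ x) x := by
    convert! (hasStrictFDerivAt_norm_sq x).hasFDerivAt.const_mul (-(1 / 2) : ℝ) using 1
    ext v
    simp
  have h2 := (h1.exp).const_mul ((2 * Real.pi) ^ ((finrank ℝ E : ℝ) / 2))⁻¹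
  convert! h2 using 1
  ext v
  simp [gaussianDensity]
  ring

variable [FiniteDimensional ℝ E] [MeasurableSpace E] [BorelSpace E]

lemma integrable_gaussianDensity : Integrable (gaussianDensity E) := by
  have h := GaussianFourier.integrable_cexp_neg_mul_sq_norm_add (V := E) (b := 1 / 2)
    (by norm_num) 0 0
  have h2 := h.norm.const_mul ((2 * Real.pi) ^ ((finrank ℝ E : ℝ) / 2))⁻¹
  refine h2.congr (Filter.Eventually.of_forall fun x => ?_)
  simp [gaussianDensity, Complex.norm_exp, ← Complex.ofReal_pow]

/-- Both measures are finite, so it suffices to compare characteristic functions; the one on the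
right is a Gaussian Fourier integral. -/
lemma stdGaussian_eq_withDensity :
    stdGaussian E = volume.withDensity (fun x => ENNReal.ofReal (gaussianDensity E x)) := by
  have : IsFiniteMeasure
      (volume.withDensity (fun x => ENNReal.ofReal (gaussianDensity E x))) :=
    isFiniteMeasure_withDensity_ofReal integrable_gaussianDensity.2
  refine Measure.ext_of_charFun ?_
  ext t
  rw [charFun_stdGaussian, charFun_apply,
    integral_withDensity_eq_integral_toReal_smul (by
      exact (continuous_gaussianDensity.measurable).ennreal_ofReal)
      (Filter.Eventually.of_forall fun x => ENNReal.ofReal_lt_top)]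
  have h := GaussianFourier.integral_cexp_neg_mul_sq_norm_add (V := E) (b := 1 / 2)
    (by norm_num) Complex.I t
  have key : ∀ x : E, (ENNReal.ofReal (gaussianDensity E x)).toReal •
      Complex.exp (⟪x, t⟫ * Complex.I) =
      (((2 * Real.pi) ^ ((finrank ℝ E : ℝ) / 2))⁻¹ : ℝ) *
        Complex.exp (-(1 / 2) * ‖x‖ ^ 2 + Complex.I * ⟪t, x⟫) := by
    intro x
    rw [ENNReal.toReal_ofReal (gaussianDensity_nonneg x), gaussianDensity, Complex.exp_add,
      real_inner_comm]
    simp only [Complex.real_smul, Complex.ofReal_mul, Complex.ofReal_exp]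
    push_cast
    ring_nf
  simp_rw [key]
  rw [integral_const_mul, h]
  have hpos : (0 : ℝ) < (2 * Real.pi) ^ ((finrank ℝ E : ℝ) / 2) := by positivity
  have e1 : ((Real.pi : ℂ) / (1 / 2)) ^ ((finrank ℝ E : ℂ) / 2) =
      (((2 * Real.pi) ^ ((finrank ℝ E : ℝ) / 2) : ℝ) : ℂ) := by
    rw [Complex.ofReal_cpow (by positivity)]
    push_cast
    congr 1
    ring
  rw [e1, ← mul_assoc, ← Complex.ofReal_mul, inv_mul_cancel₀ hpos.ne', Complex.ofReal_one, one_mul]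
  congr 1
  rw [Complex.I_sq]
  ring

lemma integral_stdGaussian (f : E → ℝ) :
    ∫ x, f x ∂(stdGaussian E) = ∫ x, gaussianDensity E x * f x := by
  rw [stdGaussian_eq_withDensity, integral_withDensity_eq_integral_toReal_smul
      (continuous_gaussianDensity.measurable).ennreal_ofReal
      (Filter.Eventually.of_forall fun x => ENNReal.ofReal_lt_top)]
  simp [ENNReal.toReal_ofReal (gaussianDensity_nonneg _)]

lemma integrable_stdGaussian_iff (f : E → ℝ) :
    Integrable f (stdGaussian E) ↔ Integrable (fun x => gaussianDensity E x * f x) := by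
  rw [stdGaussian_eq_withDensity, integrable_withDensity_iff_integrable_smul'
      (continuous_gaussianDensity.measurable).ennreal_ofReal
      (Filter.Eventually.of_forall fun x => ENNReal.ofReal_lt_top)]
  simp [ENNReal.toReal_ofReal (gaussianDensity_nonneg _)]

lemma integrable_norm_sq_stdGaussian :
    Integrable (fun y : E => ‖y‖ ^ 2) (stdGaussian E) := by
  have h : MemLp (id : E → E) 2 (stdGaussian E) := IsGaussian.memLp_id _ 2 (by norm_num)
  exact h.integrable_norm_pow (by norm_num)

lemma integrable_of_lipschitzWith {f : E → ℝ} {K : NNReal} (hL : LipschitzWith K f) (v : E) :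
    Integrable (fun y => ⟪v, y⟫ * f y) (stdGaussian E) := by
  have hb : Integrable (fun y : E => ‖v‖ * (|f 0| + (|f 0| + K) * ‖y‖ ^ 2 + K))
      (stdGaussian E) := by
    refine Integrable.const_mul ?_ _
    refine Integrable.add (Integrable.add (integrable_const _) ?_) (integrable_const _)
    exact integrable_norm_sq_stdGaussian.const_mul _
  refine hb.mono' ?_ (Filter.Eventually.of_forall fun y => ?_)
  · exact ((by fun_prop : Continuous fun y : E => ⟪v, y⟫).mul hL.continuous).aestronglyMeasurable
  · have h1 : |⟪v, y⟫| ≤ ‖v‖ * ‖y‖ := abs_real_inner_le_norm v y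
    have h2 : |f y| ≤ |f 0| + K * ‖y‖ := by
      have h3 := hL.dist_le_mul y 0
      rw [Real.dist_eq, dist_zero_right] at h3
      have h4 := abs_sub_abs_le_abs_sub (f y) (f 0)
      linarith
    rw [Real.norm_eq_abs, abs_mul]
    have hK : (0 : ℝ) ≤ K := K.2
    calc |⟪v, y⟫| * |f y| ≤ (‖v‖ * ‖y‖) * (|f 0| + K * ‖y‖) := by gcongr
      _ = ‖v‖ * (|f 0| * ‖y‖ + K * ‖y‖ ^ 2) := by ring
      _ ≤ _ := by
        refine mul_le_mul_of_nonneg_left ?_ (norm_nonneg v)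
        nlinarith [abs_nonneg (f 0), sq_nonneg (‖y‖ - 1), norm_nonneg y,
          mul_nonneg (abs_nonneg (f 0)) (sq_nonneg (‖y‖ - 1)),
          mul_nonneg (abs_nonneg (f 0)) (sq_nonneg (‖y‖))]

lemma integrable_fderiv_of_lipschitzWith {f : E → ℝ} {K : NNReal} (hL : LipschitzWith K f)
    (v : E) : Integrable (fun y => fderiv ℝ f y v) (stdGaussian E) := by
  refine (integrable_const ((K : ℝ) * ‖v‖)).mono'
    (measurable_fderiv_apply_const ℝ f v).aestronglyMeasurable
    (Filter.Eventually.of_forall fun y => ?_)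
  exact (ContinuousLinearMap.le_opNorm _ _).trans
    (mul_le_mul_of_nonneg_right (norm_fderiv_le_of_lipschitz ℝ hL) (norm_nonneg v))

/-- **Gaussian integration by parts** (Stein's identity) for Lipschitz differentiable functions. -/
theorem integral_inner_mul_stdGaussian {f : E → ℝ} {K : NNReal} (hd : Differentiable ℝ f)
    (hL : LipschitzWith K f) (v : E) :
    ∫ y, ⟪v, y⟫ * f y ∂(stdGaussian E) = ∫ y, fderiv ℝ f y v ∂(stdGaussian E) := by
  have hφ : ∀ x : E, fderiv ℝ (gaussianDensity E) x v = -(gaussianDensity E x) * ⟪v, x⟫ := by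
    intro x
    rw [(hasFDerivAt_gaussianDensity x).fderiv]
    simp [real_inner_comm]
  have i1 := (integrable_stdGaussian_iff _).1 (integrable_of_lipschitzWith hL v)
  have i2 := (integrable_stdGaussian_iff _).1 (integrable_fderiv_of_lipschitzWith hL v)
  have i3 : Integrable (fun x => gaussianDensity E x * f x) := by
    rw [← integrable_stdGaussian_iff]
    have hb : Integrable (fun y : E => |f 0| + K * (1 + ‖y‖ ^ 2)) (stdGaussian E) :=
      (integrable_const _).add
        (((integrable_const _).add integrable_norm_sq_stdGaussian).const_mul _)
    refine hb.mono' hL.continuous.aestronglyMeasurable (Filter.Eventually.of_forall fun y => ?_)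
    have h3 := hL.dist_le_mul y 0
    rw [Real.dist_eq, dist_zero_right] at h3
    have h4 := abs_sub_abs_le_abs_sub (f y) (f 0)
    have hK : (0 : ℝ) ≤ K := K.2
    rw [Real.norm_eq_abs]
    nlinarith [mul_nonneg hK (sq_nonneg (‖y‖ - 1)), mul_nonneg hK (sq_nonneg ‖y‖)]
  -- Integration by parts for Lebesgue measure, with the derivative falling on the density and
  -- producing the factor `-⟪v, x⟫`.
  have h := integral_mul_fderiv_eq_neg_fderiv_mul_of_integrable (μ := (volume : Measure E))
    (f := f) (g := gaussianDensity E) (v := v)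
    (i2.congr (Filter.Eventually.of_forall fun x => by simp only; ring))
    (i1.neg.congr (Filter.Eventually.of_forall fun x => by
      simp only [Pi.neg_apply, hφ]; ring))
    (i3.congr (Filter.Eventually.of_forall fun x => by simp only; ring))
    (fun x _ => hd x) (fun x _ => (hasFDerivAt_gaussianDensity x).differentiableAt)
  rw [integral_stdGaussian, integral_stdGaussian]
  have e1 : ∫ x, f x * fderiv ℝ (gaussianDensity E) x v =
      -∫ x, gaussianDensity E x * (⟪v, x⟫ * f x) := by
    rw [← integral_neg]
    congr 1 with x
    rw [hφ]; ring
  rw [e1, neg_inj] at h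
  rw [h]
  congr 1 with x
  ring

end Stein

/-! ### Trace and determinant inequalities. -/

section MatrixInequalities

open Matrix

variable {ι : Type*} [Fintype ι] [DecidableEq ι]

lemma exists_isHermitian_mul_self {R : Matrix ι ι ℝ} (hR : R.PosSemidef) :
    ∃ S : Matrix ι ι ℝ, S.IsHermitian ∧ S * S = R := by
  refine ⟨CFC.sqrt R, ?_, CFC.sqrt_mul_sqrt_self R hR.nonneg⟩
  exact (Matrix.nonneg_iff_posSemidef.1 (CFC.sqrt_nonneg R)).1

/-- With `R = S²`, cyclicity turns this into the trace of the positive semidefinite matrix `S (D R'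
D) S`. It gives monotonicity of the barrier gradient and positivity of its derivative. -/
lemma trace_mul_mul_mul_nonneg {R R' D : Matrix ι ι ℝ} (hR : R.PosSemidef) (hR' : R'.PosSemidef)
    (hD : D.IsHermitian) : 0 ≤ (R * D * R' * D).trace := by
  obtain ⟨S, hS, rfl⟩ := exists_isHermitian_mul_self hR
  have h1 : (D * R' * D).PosSemidef := by
    have := hR'.mul_mul_conjTranspose_same D
    rwa [hD.eq] at this
  have h2 := (h1.mul_mul_conjTranspose_same S).trace_nonneg
  rw [hS.eq, trace_mul_comm] at h2
  simpa only [Matrix.mul_assoc] using h2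

/-- If `-B ≤ A ≤ B`, then the Frobenius norm of `A` is at most the trace of `B`. -/
lemma trace_mul_self_le_sq_trace {A B : Matrix ι ι ℝ} (hA : A.IsHermitian)
    (hsub : (B - A).PosSemidef) (hadd : (B + A).PosSemidef) :
    (A * A).trace ≤ B.trace ^ 2 := by
  set U : Matrix ι ι ℝ := (hA.eigenvectorUnitary : Matrix ι ι ℝ) with hU
  have hUU : U * star U = 1 := Unitary.coe_mul_star_self _
  have hD : star U * A * U = diagonal hA.eigenvalues := by
    have := hA.conjStarAlgAut_star_eigenvectorUnitary
    rw [Unitary.conjStarAlgAut_star_apply] at this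
    simpa [hU, Function.comp_def] using this
  have htr : ∀ X : Matrix ι ι ℝ, (star U * X * U).trace = X.trace := by
    intro X
    rw [Matrix.mul_assoc, trace_mul_comm, Matrix.mul_assoc, hUU, Matrix.mul_one]
  have hAA : (A * A).trace = ∑ i, hA.eigenvalues i ^ 2 := by
    rw [← htr, show star U * (A * A) * U = (star U * A * U) * (star U * A * U) by
      calc star U * (A * A) * U = star U * A * 1 * A * U := by simp only [Matrix.mul_assoc,
            Matrix.mul_one]
        _ = _ := by rw [← hUU]; simp only [Matrix.mul_assoc], hD, diagonal_mul_diagonal,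
      trace_diagonal]
    simp [sq]
  set B' := star U * B * U with hB'
  -- In an eigenbasis of `A`, only the diagonal entries of the conjugated `B ± A` are needed.
  have hdiag : ∀ i, |hA.eigenvalues i| ≤ B' i i := by
    intro i
    have h1 := (hsub.conjTranspose_mul_mul_same U).diag_nonneg (i := i)
    have h2 := (hadd.conjTranspose_mul_mul_same U).diag_nonneg (i := i)
    rw [← star_eq_conjTranspose, Matrix.mul_sub, Matrix.sub_mul, hD] at h1
    rw [← star_eq_conjTranspose, Matrix.mul_add, Matrix.add_mul, hD] at h2
    simp only [Matrix.sub_apply, Matrix.add_apply, diagonal_apply_eq] at h1 h2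
    rw [abs_le]
    constructor <;> linarith
  have hBtr : B.trace = ∑ i, B' i i := by
    rw [← htr B]; rfl
  rw [hAA, hBtr]
  calc ∑ i, hA.eigenvalues i ^ 2 = ∑ i, |hA.eigenvalues i| ^ 2 := by simp
    _ ≤ ∑ i, B' i i ^ 2 := Finset.sum_le_sum fun i _ => by
        have := hdiag i
        gcongr
    _ ≤ (∑ i, B' i i) ^ 2 :=
        Finset.sum_sq_le_sq_sum_of_nonneg fun i _ => (abs_nonneg _).trans (hdiag i)

/-- Conjugating by a square root `S` of `R` preserves `-B ≤ A ≤ B` and reduces to the case `R = 1`.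
-/
lemma trace_mul_mul_mul_le_sq {R A B : Matrix ι ι ℝ} (hR : R.PosSemidef) (hA : A.IsHermitian)
    (hsub : (B - A).PosSemidef) (hadd : (B + A).PosSemidef) :
    (R * A * R * A).trace ≤ (R * B).trace ^ 2 := by
  obtain ⟨S, hS, rfl⟩ := exists_isHermitian_mul_self hR
  have h := trace_mul_self_le_sq_trace (A := S * A * S) (B := S * B * S)
    (by have := isHermitian_mul_mul_conjTranspose S hA; rwa [hS.eq] at this)
    (by
      have := hsub.mul_mul_conjTranspose_same S
      rwa [hS.eq, Matrix.mul_sub, Matrix.sub_mul] at this)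
    (by
      have := hadd.mul_mul_conjTranspose_same S
      rwa [hS.eq, Matrix.mul_add, Matrix.add_mul] at this)
  have e1 : (S * B * S).trace = (S * S * B).trace := by
    rw [trace_mul_comm, Matrix.mul_assoc]
  have e2 : (S * A * S * (S * A * S)).trace = (S * S * A * (S * S) * A).trace := by
    rw [← Matrix.mul_assoc (S * A * S), trace_mul_comm]
    simp only [Matrix.mul_assoc]
  rwa [e1, e2] at h

lemma trace_mul_le_trace_mul {R A B : Matrix ι ι ℝ} (hR : R.PosSemidef)
    (h : (B - A).PosSemidef) : (R * A).trace ≤ (R * B).trace := by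
  obtain ⟨S, hS, rfl⟩ := exists_isHermitian_mul_self hR
  have := (h.mul_mul_conjTranspose_same S).trace_nonneg
  rw [hS.eq, trace_mul_comm, ← Matrix.mul_assoc, Matrix.mul_sub, trace_sub] at this
  linarith

/-- Multiply `λ ≤ exp (λ - 1)` over the eigenvalues. This bounds the growth of the determinant on
the possibly unbounded spectrahedron. -/
lemma det_le_exp_trace {M : Matrix ι ι ℝ} (hM : M.PosSemidef) :
    M.det ≤ Real.exp (M.trace - Fintype.card ι) := by
  rw [hM.1.det_eq_prod_eigenvalues, hM.1.trace_eq_sum_eigenvalues]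
  calc ∏ i, (hM.1.eigenvalues i : ℝ) ≤ ∏ i, Real.exp (hM.1.eigenvalues i - 1) :=
        Finset.prod_le_prod (fun i _ => hM.eigenvalues_nonneg i) fun i _ => by
          have := Real.add_one_le_exp (hM.1.eigenvalues i - 1)
          simpa using this
    _ = _ := by
        rw [← Real.exp_sum, Finset.sum_sub_distrib]
        simp

lemma sub_smul_one_posSemidef {M : Matrix ι ι ℝ} (hM : M.IsHermitian) {k : ℝ}
    (hk : ∀ i, k ≤ hM.eigenvalues i) : (M - k • (1 : Matrix ι ι ℝ)).PosSemidef := by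
  set U : Matrix ι ι ℝ := (hM.eigenvectorUnitary : Matrix ι ι ℝ) with hU
  have hUU : U * star U = 1 := Unitary.coe_mul_star_self _
  have h := hM.spectral_theorem
  rw [Unitary.conjStarAlgAut_apply] at h
  have h1 : M - k • (1 : Matrix ι ι ℝ) =
      U * diagonal (fun i => hM.eigenvalues i - k) * Uᴴ := by
    have : diagonal (fun i => hM.eigenvalues i - k) =
        diagonal hM.eigenvalues - k • (1 : Matrix ι ι ℝ) := by
      ext i j
      by_cases hij : i = j <;> simp [hij]
    rw [this, Matrix.mul_sub, Matrix.sub_mul, ← star_eq_conjTranspose, Matrix.mul_smul,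
      Matrix.mul_one, Matrix.smul_mul, hUU]
    congr 1
  rw [h1]
  exact (PosSemidef.diagonal fun i => sub_nonneg.2 (hk i)).mul_mul_conjTranspose_same U

/-- If `M ≥ d` and `N ≥ -k`, then `M + t N ≥ d - t k > 0` for `0 ≤ t < d / k`; negative `t` is the
same statement for `-N`. -/
lemma eventually_posDef_add_smul {M N : Matrix ι ι ℝ} (hM : M.PosDef) (hN : N.IsHermitian) :
    ∀ᶠ t : ℝ in nhds 0, (M + t • N).PosDef := by
  obtain ⟨d, hd, hdM⟩ : ∃ d > 0, ∀ i, d ≤ hM.1.eigenvalues i := by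
    rcases isEmpty_or_nonempty ι with h | h
    · exact ⟨1, one_pos, fun i => h.elim i⟩
    · obtain ⟨i, hi⟩ := Finite.exists_min hM.1.eigenvalues
      exact ⟨_, hM.eigenvalues_pos i, hi⟩
  have key : ∀ {N : Matrix ι ι ℝ}, N.IsHermitian → ∀ᶠ t : ℝ in nhds 0, 0 ≤ t →
      (M + t • N).PosDef := by
    intro N hN
    obtain ⟨k, hk, hkN⟩ : ∃ k > 0, ∀ i, -k ≤ hN.eigenvalues i := by
      refine ⟨1 + ∑ i, |hN.eigenvalues i|, by positivity, fun i => ?_⟩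
      have h1 : |hN.eigenvalues i| ≤ ∑ i, |hN.eigenvalues i| :=
        Finset.single_le_sum (f := fun i => |hN.eigenvalues i|)
          (fun i _ => abs_nonneg _) (Finset.mem_univ i)
      have h2 := neg_abs_le (hN.eigenvalues i)
      linarith
    have hlt : ∀ᶠ t : ℝ in nhds 0, t < d / k := eventually_lt_nhds (by positivity)
    filter_upwards [hlt] with t ht ht0
    rw [lt_div_iff₀ hk] at ht
    have h1 := sub_smul_one_posSemidef hM.1 hdM
    have h2 := (sub_smul_one_posSemidef hN hkN).smul ht0
    have h3 : ((d - t * k) • (1 : Matrix ι ι ℝ)).PosDef :=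
      PosDef.one.smul (sub_pos.2 ht)
    have h4 := (h3.add_posSemidef h1).add_posSemidef h2
    convert h4 using 1
    module
  have hneg : Filter.Tendsto (fun t : ℝ => -t) (nhds 0) (nhds 0) := by
    simpa using (continuous_neg (G := ℝ)).tendsto 0
  filter_upwards [key hN, hneg.eventually (key hN.neg)] with t h1 h2
  rcases le_total 0 t with h | h
  · exact h1 h
  · simpa using h2 (by linarith)

/-- Jacobi's formula: factor out `det M` and expand `det (1 + t X) = 1 + t tr X + O(t²)`. -/
lemma hasDerivAt_det_add_smul {M : Matrix ι ι ℝ} (hM : IsUnit M.det) (N : Matrix ι ι ℝ) :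
    HasDerivAt (fun t : ℝ => (M + t • N).det) (M.det * (M⁻¹ * N).trace) 0 := by
  have e : ∀ t : ℝ, (M + t • N).det = M.det * (1 + t • (M⁻¹ * N)).det := by
    intro t
    rw [← det_mul, Matrix.mul_add, Matrix.mul_one, Matrix.mul_smul, ← Matrix.mul_assoc,
      mul_nonsing_inv _ hM, Matrix.one_mul]
  obtain ⟨p, hp⟩ : ∃ p : Polynomial ℝ, ∀ t : ℝ, (1 + t • (M⁻¹ * N)).det =
      1 + (M⁻¹ * N).trace * t + p.eval t * t ^ 2 := ⟨_, fun t => det_one_add_smul t _⟩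
  have e' : (fun t : ℝ => (M + t • N).det) =
      fun t => M.det * (1 + (M⁻¹ * N).trace * t + p.eval t * t ^ 2) :=
    funext fun t => by rw [e, hp]
  rw [e']
  have h1 : HasDerivAt (fun t : ℝ => 1 + (M⁻¹ * N).trace * t + p.eval t * t ^ 2)
      ((M⁻¹ * N).trace * 1 + (p.derivative.eval 0 * 0 ^ 2 + p.eval 0 * (2 * 0 ^ 1 * 1))) 0 :=
    (((hasDerivAt_id (0 : ℝ)).const_mul _).const_add 1).add
      ((p.hasDerivAt 0).mul (by simpa using hasDerivAt_pow 2 (0 : ℝ)))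
  simpa using h1.const_mul M.det

end MatrixInequalities

/-! ### The log-determinant barrier and its proximal map. -/

section Barrier

open Matrix Module Filter Topology
open scoped RealInnerProductSpace

variable {ι : Type*} [DecidableEq ι] {E : Type*} [NormedAddCommGroup E]
  [InnerProductSpace ℝ E]

/-- The slack matrix `c I - 𝒜 x` of the spectral constraint `𝒜 x ⪯ c I`. -/
def slack (𝒜 : E →ₗ[ℝ] Matrix ι ι ℝ) (c : ℝ) (x : E) : Matrix ι ι ℝ := c • 1 - 𝒜 x

variable {𝒜 : E →ₗ[ℝ] Matrix ι ι ℝ} {c : ℝ}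

lemma slack_isHermitian (h𝒜 : ∀ x, (𝒜 x).IsHermitian) (x : E) : (slack 𝒜 c x).IsHermitian := by
  refine IsHermitian.sub ?_ (h𝒜 x)
  simp [IsHermitian]

lemma slack_sub (x x' : E) : slack 𝒜 c x' - slack 𝒜 c x = 𝒜 (x - x') := by
  simp [slack]

lemma slack_add_smul (x u : E) (t : ℝ) :
    slack 𝒜 c (x + t • u) = slack 𝒜 c x + t • (-𝒜 u) := by
  simp [slack]
  abel

lemma continuous_slack [FiniteDimensional ℝ E] : Continuous (slack 𝒜 c) :=
  continuous_const.sub 𝒜.continuous_of_finiteDimensional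

variable [Fintype ι] {κ : Type*} [Fintype κ]

/-- The vector representing the functional `u ↦ μ tr (X 𝒜 u)` in an orthonormal basis. -/
noncomputable def traceDual (𝒜 : E →ₗ[ℝ] Matrix ι ι ℝ) (b : OrthonormalBasis κ ℝ E) (μ : ℝ) :
    Matrix ι ι ℝ →ₗ[ℝ] E where
  toFun X := ∑ i, (μ * (X * 𝒜 (b i)).trace) • b i
  map_add' X Y := by
    simp [Matrix.add_mul, mul_add, add_smul, Finset.sum_add_distrib]
  map_smul' r X := by
    simp [Finset.smul_sum, smul_smul, mul_left_comm]

/-- The gradient of the log-determinant barrier `x ↦ -μ log det (c I - 𝒜 x)`. -/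
noncomputable def barrierGrad (𝒜 : E →ₗ[ℝ] Matrix ι ι ℝ) (b : OrthonormalBasis κ ℝ E) (μ c : ℝ)
    (x : E) : E :=
  traceDual 𝒜 b μ (slack 𝒜 c x)⁻¹

variable (𝒜) (b : OrthonormalBasis κ ℝ E) (μ : ℝ) (c)

lemma inner_traceDual (X : Matrix ι ι ℝ) (u : E) :
    ⟪traceDual 𝒜 b μ X, u⟫ = μ * (X * 𝒜 u).trace := by
  conv_rhs => rw [← b.sum_repr' u]
  simp only [traceDual, LinearMap.coe_mk, AddHom.coe_mk, sum_inner, inner_smul_left, map_sum,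
    map_smul, Matrix.mul_smul, trace_sum, trace_smul, Finset.mul_sum]
  refine Finset.sum_congr rfl fun i _ => ?_
  simp
  ring

lemma inner_barrierGrad (x u : E) :
    ⟪barrierGrad 𝒜 b μ c x, u⟫ = μ * ((slack 𝒜 c x)⁻¹ * 𝒜 u).trace :=
  inner_traceDual 𝒜 b μ _ u

variable {𝒜 c}

/-- Monotonicity of the barrier gradient. -/
lemma inner_barrierGrad_sub_nonneg {μ : ℝ} (hμ : 0 ≤ μ) (h𝒜 : ∀ x, (𝒜 x).IsHermitian) {x x' : E}
    (hx : (slack 𝒜 c x).PosDef) (hx' : (slack 𝒜 c x').PosDef) :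
    0 ≤ ⟪barrierGrad 𝒜 b μ c x - barrierGrad 𝒜 b μ c x', x - x'⟫ := by
  rw [inner_sub_left, inner_barrierGrad, inner_barrierGrad, ← mul_sub, ← trace_sub,
    ← Matrix.sub_mul]
  refine mul_nonneg hμ ?_
  have h1 := (isUnit_iff_isUnit_det _).1 hx.isUnit
  have h2 := (isUnit_iff_isUnit_det _).1 hx'.isUnit
  -- The resolvent identity.
  have e : (slack 𝒜 c x)⁻¹ - (slack 𝒜 c x')⁻¹ =
      (slack 𝒜 c x)⁻¹ * 𝒜 (x - x') * (slack 𝒜 c x')⁻¹ := by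
    rw [← slack_sub (c := c), Matrix.mul_sub, Matrix.sub_mul, nonsing_inv_mul _ h1, Matrix.one_mul,
      Matrix.mul_assoc, mul_nonsing_inv _ h2, Matrix.mul_one]
  rw [e]
  exact trace_mul_mul_mul_nonneg hx.inv.posSemidef hx'.inv.posSemidef (h𝒜 _)

lemma inner_barrierGrad_self {x : E} (hx : (slack 𝒜 c x).PosDef) :
    ⟪barrierGrad 𝒜 b μ c x, x⟫ = μ * (c * (slack 𝒜 c x)⁻¹.trace - Fintype.card ι) := by
  rw [inner_barrierGrad]
  have h1 := (isUnit_iff_isUnit_det _).1 hx.isUnit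
  have e : 𝒜 x = c • 1 - slack 𝒜 c x := by simp [slack]
  rw [e, Matrix.mul_sub, nonsing_inv_mul _ h1, trace_sub, trace_one, Matrix.mul_smul,
    Matrix.mul_one, trace_smul, smul_eq_mul]

variable [FiniteDimensional ℝ E]

lemma isClosed_slack_posSemidef (h𝒜 : ∀ x, (𝒜 x).IsHermitian) :
    IsClosed {x | (slack 𝒜 c x).PosSemidef} := by
  have : {x | (slack 𝒜 c x).PosSemidef} =
      ⋂ v : ι → ℝ, {x | 0 ≤ v ⬝ᵥ (slack 𝒜 c x *ᵥ v)} := by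
    ext x
    have := slack_isHermitian (c := c) h𝒜 x
    simp only [posSemidef_iff_dotProduct_mulVec, this, true_and, Set.mem_ofPred_eq, Set.mem_iInter,
      star_trivial]
  rw [this]
  refine isClosed_iInter fun v => isClosed_le continuous_const ?_
  have := continuous_slack (𝒜 := 𝒜) (c := c)
  exact continuous_const.dotProduct (this.matrix_mulVec continuous_const)

/-- The penalised determinant `det (c I - 𝒜 x) exp (-‖x - y‖² / (2 μ))` attains its maximum over the
spectrahedron. -/
lemma exists_isMaxOn_det_mul_exp {μ : ℝ} (hμ : 0 < μ) (hc : 0 < c)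
    (h𝒜 : ∀ x, (𝒜 x).IsHermitian) (y : E) :
    ∃ x ∈ {x | (slack 𝒜 c x).PosSemidef},
      IsMaxOn (fun x => (slack 𝒜 c x).det * Real.exp (-‖x - y‖ ^ 2 / (2 * μ)))
        {x | (slack 𝒜 c x).PosSemidef} x ∧
      0 < (slack 𝒜 c x).det * Real.exp (-‖x - y‖ ^ 2 / (2 * μ)) := by
  set h : E → ℝ := fun x => (slack 𝒜 c x).det * Real.exp (-‖x - y‖ ^ 2 / (2 * μ)) with hh
  have h0 : (slack 𝒜 c 0).PosDef := by
    simpa [slack] using PosDef.one.smul hc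
  have hpos : 0 < h 0 := mul_pos h0.det_pos (Real.exp_pos _)
  have hcont : Continuous h := by
    have := (continuous_slack (𝒜 := 𝒜) (c := c)).matrix_det
    fun_prop
  let τ : E →L[ℝ] ℝ := LinearMap.toContinuousLinearMap ((traceLinearMap ι ℝ ℝ).comp 𝒜)
  have hτ : ∀ x, |(𝒜 x).trace| ≤ ‖τ‖ * ‖x‖ := fun x => τ.le_opNorm x
  set a : ℝ := c * Fintype.card ι - Fintype.card ι
  set T := Real.log (h 0) with hT
  have hev : ∀ᶠ x in cocompact E ⊓ 𝓟 {x | (slack 𝒜 c x).PosSemidef}, h x ≤ h 0 := by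
    have hn := tendsto_norm_cocompact_atTop (E := E)
    rw [eventually_inf_principal]
    -- `log h x` is at most `a + ‖τ‖‖x‖ + ‖y‖² / (2μ) - ‖x‖² / (4μ)`. The first threshold reduces
    -- the terms in `‖x‖` to at most `-‖x‖`, and the second brings the total below `T`.
    filter_upwards [hn.eventually_ge_atTop (4 * μ * (‖τ‖ + 1)),
      hn.eventually_ge_atTop (a + ‖y‖ ^ 2 / (2 * μ) - T)] with x hx1 hx2 hx
    have h1 := det_le_exp_trace hx
    have h2 : (slack 𝒜 c x).trace - Fintype.card ι ≤ a + ‖τ‖ * ‖x‖ := by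
      have := (abs_le.1 (hτ x)).1
      simp only [slack, trace_sub, trace_smul, trace_one, smul_eq_mul, a]
      linarith
    have h3 : ‖x‖ ^ 2 / 2 - ‖y‖ ^ 2 ≤ ‖x - y‖ ^ 2 := by
      have := norm_sub_norm_le x (x - y)
      rw [sub_sub_cancel] at this
      nlinarith [norm_nonneg x, norm_nonneg y, norm_nonneg (x - y),
        sq_nonneg (‖x - y‖ - ‖y‖)]
    have h4 : -‖x - y‖ ^ 2 / (2 * μ) ≤ ‖y‖ ^ 2 / (2 * μ) - ‖x‖ * (‖x‖ / (4 * μ)) := by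
      have : ‖y‖ ^ 2 / (2 * μ) - ‖x‖ * (‖x‖ / (4 * μ)) =
          -(‖x‖ ^ 2 / 2 - ‖y‖ ^ 2) / (2 * μ) := by
        field_simp
        ring
      rw [this]
      gcongr
    have h5 : ‖x‖ * (‖τ‖ + 1) ≤ ‖x‖ * (‖x‖ / (4 * μ)) := by
      refine mul_le_mul_of_nonneg_left ?_ (norm_nonneg x)
      rw [le_div_iff₀ (by positivity)]
      linarith
    calc h x ≤ Real.exp ((slack 𝒜 c x).trace - Fintype.card ι) *
          Real.exp (-‖x - y‖ ^ 2 / (2 * μ)) := by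
            simp only [hh]
            gcongr
      _ ≤ Real.exp T := by
          rw [← Real.exp_add, Real.exp_le_exp]
          linarith
      _ = h 0 := Real.exp_log hpos
  obtain ⟨x, hx, hmax⟩ := hcont.continuousOn.exists_isMaxOn' (isClosed_slack_posSemidef h𝒜)
    (show (0 : E) ∈ {x | (slack 𝒜 c x).PosSemidef} from h0.posSemidef) hev
  exact ⟨x, hx, hmax, hpos.trans_le (hmax h0.posSemidef)⟩

/-- The map `x ↦ x + ∇Ψ(x)` of the log-determinant barrier `Ψ` is onto. -/
lemma exists_add_barrierGrad_eq {μ : ℝ} (hμ : 0 < μ) (hc : 0 < c)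
    (h𝒜 : ∀ x, (𝒜 x).IsHermitian) (y : E) :
    ∃ x, (slack 𝒜 c x).PosDef ∧ x + barrierGrad 𝒜 b μ c x = y := by
  obtain ⟨x, hx, hmax, hpos⟩ := exists_isMaxOn_det_mul_exp hμ hc h𝒜 y
  have hdet : 0 < (slack 𝒜 c x).det := pos_of_mul_pos_left hpos (Real.exp_pos _).le
  -- Since the determinant vanishes on singular slack matrices, a positive maximum keeps the
  -- maximiser off them. Stationarity along each line then gives the gradient equation.
  have hPD : (slack 𝒜 c x).PosDef := (PosSemidef.posDef_iff_det_ne_zero hx).2 hdet.ne'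
  refine ⟨x, hPD, ?_⟩
  suffices h : barrierGrad 𝒜 b μ c x = y - x by rw [h]; abel
  refine ext_inner_right ℝ fun u => ?_
  rw [inner_barrierGrad]
  have hlm : IsLocalMax (fun t : ℝ => (slack 𝒜 c x + t • (-𝒜 u)).det *
      Real.exp (-‖x + t • u - y‖ ^ 2 / (2 * μ))) 0 := by
    filter_upwards [eventually_posDef_add_smul hPD (h𝒜 u).neg] with t ht
    rw [← slack_add_smul] at ht
    have := hmax ht.posSemidef
    simp only [zero_smul, add_zero, ← slack_add_smul]
    exact this
  have hd1 := hasDerivAt_det_add_smul (M := slack 𝒜 c x) hdet.ne'.isUnit (-𝒜 u)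
  have hd2 : HasDerivAt (fun t : ℝ => ‖x + t • u - y‖ ^ 2) (2 * ⟪x - y, u⟫) 0 := by
    have h1 : HasDerivAt (fun t : ℝ => x + t • u - y) u 0 := by
      simpa using (((hasDerivAt_id (0 : ℝ)).smul_const u).const_add x).sub_const y
    simpa using h1.norm_sq
  have hd3 := hd1.mul ((hd2.neg.div_const (2 * μ)).exp)
  have hz := hlm.hasDerivAt_eq_zero hd3
  simp only [zero_smul, add_zero, Matrix.mul_neg, trace_neg, Pi.neg_apply] at hz
  set e := Real.exp (-‖x - y‖ ^ 2 / (2 * μ))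
  have he : 0 < e := Real.exp_pos _
  have hfac : (slack 𝒜 c x).det * e *
      (((slack 𝒜 c x)⁻¹ * 𝒜 u).trace + ⟪x - y, u⟫ / μ) = 0 := by
    rw [← neg_eq_zero, ← hz]
    field_simp
    ring
  have h0 := (mul_eq_zero.1 hfac).resolve_left (mul_pos hdet he).ne'
  rw [inner_sub_left] at h0 ⊢
  field_simp at h0
  linarith

end Barrier

/-! ### Regularity of the proximal map and its derivative. -/

section BarrierDerivative

open Matrix Module Filter Topology
open scoped RealInnerProductSpace Matrix.Norms.L2Operator

variable {ι : Type*} [DecidableEq ι] [Fintype ι] {E : Type*} [NormedAddCommGroup E]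
  [InnerProductSpace ℝ E] {κ : Type*} [Fintype κ]
  {𝒜 : E →ₗ[ℝ] Matrix ι ι ℝ} {c : ℝ} (b : OrthonormalBasis κ ℝ E)

/-- A right inverse of `x ↦ x + ∇Ψ(x)` is nonexpansive. -/
lemma norm_sub_le_of_add_barrierGrad_eq {μ : ℝ} (hμ : 0 ≤ μ) (h𝒜 : ∀ x, (𝒜 x).IsHermitian)
    {p : E → E} (hp : ∀ y, (slack 𝒜 c (p y)).PosDef)
    (hpy : ∀ y, p y + barrierGrad 𝒜 b μ c (p y) = y) (y y' : E) :
    ‖p y - p y'‖ ≤ ‖y - y'‖ := by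
  have h := inner_barrierGrad_sub_nonneg b hμ h𝒜 (hp y) (hp y')
  have e : barrierGrad 𝒜 b μ c (p y) - barrierGrad 𝒜 b μ c (p y') =
      (y - y') - (p y - p y') := by
    conv_rhs => rw [← hpy y, ← hpy y']
    simp only [hpy]
    rw [← sub_eq_zero]
    nth_rewrite 1 [← add_sub_cancel_left (p y) (barrierGrad 𝒜 b μ c (p y))]
    nth_rewrite 1 [← add_sub_cancel_left (p y') (barrierGrad 𝒜 b μ c (p y'))]
    simp only [hpy]
    abel
  -- Monotonicity now reads `‖p y - p y'‖² ≤ ⟪y - y', p y - p y'⟫`, and Cauchy–Schwarz concludes.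
  rw [e, inner_sub_left, real_inner_self_eq_norm_sq] at h
  have h2 := real_inner_le_norm (y - y') (p y - p y')
  rcases (norm_nonneg (p y - p y')).eq_or_lt with h0 | h0
  · rw [← h0]; exact norm_nonneg _
  · nlinarith

variable [FiniteDimensional ℝ E]

lemma exists_hasFDerivAt_barrierGrad (μ : ℝ) {x : E} (hx : (slack 𝒜 c x).PosDef) :
    ∃ J : E →L[ℝ] E, HasFDerivAt (barrierGrad 𝒜 b μ c) J x ∧
      ∀ u w, ⟪J u, w⟫ =
        μ * ((slack 𝒜 c x)⁻¹ * 𝒜 u * (slack 𝒜 c x)⁻¹ * 𝒜 w).trace := by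
  let AL : E →L[ℝ] Matrix ι ι ℝ := LinearMap.toContinuousLinearMap 𝒜
  let Λ : Matrix ι ι ℝ →L[ℝ] E := LinearMap.toContinuousLinearMap (traceDual 𝒜 b μ)
  obtain ⟨U, hU⟩ := hx.isUnit
  have hUinv : ((U⁻¹ : (Matrix ι ι ℝ)ˣ) : Matrix ι ι ℝ) = (slack 𝒜 c x)⁻¹ := by
    rw [← hU, Matrix.coe_units_inv]
  have h1 : HasFDerivAt (slack 𝒜 c) (-AL) x := by
    have := AL.hasFDerivAt (x := x)
    exact this.const_sub (c • (1 : Matrix ι ι ℝ))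
  have h2 := hasFDerivAt_ringInverse (𝕜 := ℝ) U
  rw [hU] at h2
  have h3 := (Λ.hasFDerivAt (x := Ring.inverse (slack 𝒜 c x))).comp x (h2.comp x h1)
  refine ⟨_, h3.congr_of_eventuallyEq (Eventually.of_forall fun z => ?_), fun u w => ?_⟩
  · simp only [barrierGrad, nonsing_inv_eq_ringInverse]
    rfl
  · have : Λ ((-(ContinuousLinearMap.mulLeftRight ℝ (Matrix ι ι ℝ)) ↑U⁻¹ ↑U⁻¹) ((-AL) u)) =
        traceDual 𝒜 b μ ((slack 𝒜 c x)⁻¹ * 𝒜 u * (slack 𝒜 c x)⁻¹) := by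
      simp only [hUinv, _root_.neg_apply, ContinuousLinearMap.mulLeftRight_apply,
        Matrix.mul_neg, Matrix.neg_mul, neg_neg]
      rfl
    simp only [ContinuousLinearMap.comp_apply]
    rw [this, inner_traceDual]

/-- For a positive semidefinite form `J` and `w + J w = e` with `‖e‖ = 1`, the quantity
`⟪e, J w⟫ = ⟪e, J (1 + J)⁻¹ e⟫` is at most `√⟪e, J e⟫ / 2`. -/
lemma inner_apply_le_half {F : Type*} [NormedAddCommGroup F] [InnerProductSpace ℝ F]
    {J : F →L[ℝ] F} (hsymm : ∀ u w, ⟪J u, w⟫ = ⟪J w, u⟫) (hnn : ∀ u, 0 ≤ ⟪J u, u⟫)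
    {e w : F} (he : ‖e‖ = 1) (hw : w + J w = e) {s : ℝ} (hs : 0 ≤ s) (hJ : ⟪J e, e⟫ ≤ s ^ 2) :
    1 - ⟪e, w⟫ ≤ s / 2 := by
  have hee : ⟪e, e⟫ = 1 := by rw [real_inner_self_eq_norm_sq, he, one_pow]
  have hJw : J w = e - w := by rw [← hw]; abel
  have h1 : ⟪J w, e⟫ = 1 - ⟪e, w⟫ := by rw [hJw, inner_sub_left, hee, real_inner_comm]
  -- Here `⟪J w, w⟫ = ⟪e, w⟫ - ‖w‖² ≤ ‖w‖ - ‖w‖²`.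
  have h2 : ⟪J w, w⟫ ≤ 1 / 4 := by
    rw [hJw, inner_sub_left, real_inner_self_eq_norm_sq]
    have := real_inner_le_norm e w
    rw [he, one_mul] at this
    nlinarith [sq_nonneg (‖w‖ - 1 / 2)]
  set q := 1 - ⟪e, w⟫
  refine le_of_forall_pos_le_add fun δ hδ => ?_
  have hq : ∀ t : ℝ, 0 ≤ t ^ 2 * ⟪J e, e⟫ - 2 * t * q + ⟪J w, w⟫ := by
    intro t
    have := hnn (t • e - w)
    rw [map_sub, map_smul, inner_sub_left, inner_sub_right, inner_sub_right, inner_smul_left,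
      inner_smul_left, inner_smul_right, inner_smul_right, hsymm e w, h1] at this
    simp only [conj_trivial] at this
    linarith
  -- The choice `t = 1 / (2 s)` makes the quadratic term at most `1 / 4`; `δ` covers `s = 0`.
  have ht := hq (1 / (2 * (s + δ)))
  have hsd : 0 < s + δ := by linarith
  have h3 : (1 / (2 * (s + δ))) ^ 2 * ⟪J e, e⟫ ≤ 1 / 4 := by
    rw [div_pow, one_pow, div_mul_eq_mul_div, one_mul, div_le_iff₀ (by positivity)]
    nlinarith
  have h4 : 2 * (1 / (2 * (s + δ))) * q = q / (s + δ) := by field_simp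
  rw [h4] at ht
  have h5 : q / (s + δ) ≤ 1 / 2 := by linarith
  rw [div_le_iff₀ hsd] at h5
  linarith

/-- Differentiability of a right inverse of `x ↦ x + ∇Ψ(x)`, and a bound on the diagonal entries of
the derivative of the complementary map. -/
lemma differentiableAt_of_add_barrierGrad_eq {μ : ℝ} (hμ : 0 < μ) (h𝒜 : ∀ x, (𝒜 x).IsHermitian)
    {p : E → E} (hp : ∀ y, (slack 𝒜 c (p y)).PosDef)
    (hpy : ∀ y, p y + barrierGrad 𝒜 b μ c (p y) = y) (y : E) :
    DifferentiableAt ℝ p y ∧ ∀ (e : E) (B : Matrix ι ι ℝ), ‖e‖ = 1 → (B - 𝒜 e).PosSemidef →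
      (B + 𝒜 e).PosSemidef →
      1 - ⟪e, fderiv ℝ p y e⟫ ≤ √μ * ((slack 𝒜 c (p y))⁻¹ * B).trace / 2 := by
  obtain ⟨J, hJ, hJinner⟩ := exists_hasFDerivAt_barrierGrad b μ (hp y)
  set R := (slack 𝒜 c (p y))⁻¹ with hR
  have hRp : R.PosSemidef := (hp y).inv.posSemidef
  have hnn : ∀ u, 0 ≤ ⟪J u, u⟫ := fun u => by
    rw [hJinner]
    exact mul_nonneg hμ.le (trace_mul_mul_mul_nonneg hRp hRp (h𝒜 u))
  have hsymm : ∀ u w, ⟪J u, w⟫ = ⟪J w, u⟫ := fun u w => by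
    rw [hJinner, hJinner, Matrix.mul_assoc (R * 𝒜 u), trace_mul_comm, ← Matrix.mul_assoc]
  have hinj : Function.Injective (ContinuousLinearMap.id ℝ E + J : E →L[ℝ] E) := by
    rw [injective_iff_map_eq_zero]
    intro u hu
    have h1 := hnn u
    have h2 : J u = -u := by
      rw [eq_neg_iff_add_eq_zero, add_comm]
      exact hu
    rw [h2, inner_neg_left, real_inner_self_eq_norm_sq] at h1
    have : ‖u‖ = 0 := by nlinarith [norm_nonneg u]
    exact norm_eq_zero.1 this
  let L : E ≃L[ℝ] E := (LinearEquiv.ofInjectiveEndo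
    ((ContinuousLinearMap.id ℝ E + J : E →L[ℝ] E) : E →ₗ[ℝ] E) hinj).toContinuousLinearEquiv
  have hL : (L : E →L[ℝ] E) = ContinuousLinearMap.id ℝ E + J := by
    ext u; rfl
  have hcont : ContinuousAt p y := by
    refine (LipschitzWith.of_dist_le_mul (K := 1) fun y y' => ?_).continuous.continuousAt
    simpa [dist_eq_norm] using norm_sub_le_of_add_barrierGrad_eq b hμ.le h𝒜 hp hpy y y'
  have hF : HasFDerivAt (fun x => x + barrierGrad 𝒜 b μ c x) (L : E →L[ℝ] E) (p y) := by
    rw [hL]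
    exact (hasFDerivAt_id (p y)).add hJ
  -- Continuity of `p` and invertibility of `1 + J` give `Dp = (1 + J)⁻¹`.
  have hderiv := HasFDerivAt.of_local_left_inverse hcont hF (Eventually.of_forall hpy)
  refine ⟨hderiv.differentiableAt, fun e B he hsub hadd => ?_⟩
  rw [hderiv.fderiv]
  have hw : L.symm e + J (L.symm e) = e := by
    have : (L : E →L[ℝ] E) (L.symm e) = e := L.apply_symm_apply e
    rw [hL] at this
    exact this
  have hB : 0 ≤ (R * B).trace := by
    have hBp : (B - 0).PosSemidef := by
      have h := (hsub.add hadd).smul (show (0 : ℝ) ≤ 1 / 2 by norm_num)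
      convert h using 1
      module
    simpa using trace_mul_le_trace_mul hRp hBp
  refine inner_apply_le_half hsymm hnn he hw (by positivity) ?_
  rw [hJinner, mul_pow, Real.sq_sqrt hμ.le]
  exact mul_le_mul_of_nonneg_left (trace_mul_mul_mul_le_sq hRp (h𝒜 e) hsub hadd) hμ.le

end BarrierDerivative

/-! ### Mean squared displacement and Markov's inequality. -/

section GaussianDistance

open Matrix Module MeasureTheory ProbabilityTheory
open scoped RealInnerProductSpace ENNReal

variable {ι : Type*} [DecidableEq ι] [Fintype ι] {E : Type*} [NormedAddCommGroup E]
  [InnerProductSpace ℝ E] [FiniteDimensional ℝ E] [MeasurableSpace E] [BorelSpace E]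
  {κ : Type*} [Fintype κ] {𝒜 : E →ₗ[ℝ] Matrix ι ι ℝ} {c : ℝ}

/-- There is a map into the spectrahedron `𝒜 x ≺ c I` whose mean squared displacement under the
standard Gaussian measure is at most `card ι / (4 c²)`. -/
theorem exists_integral_norm_sq_sub_le (b : OrthonormalBasis κ ℝ E) (hc : 0 < c)
    (h𝒜 : ∀ x, (𝒜 x).IsHermitian) {B : κ → Matrix ι ι ℝ}
    (hsub : ∀ i, (B i - 𝒜 (b i)).PosSemidef) (hadd : ∀ i, (B i + 𝒜 (b i)).PosSemidef)
    (hB : (1 - ∑ i, B i).PosSemidef) :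
    ∃ p : E → E, Continuous p ∧ (∀ y, (slack 𝒜 c (p y)).PosDef) ∧
      Integrable (fun y => ‖y - p y‖ ^ 2) (stdGaussian E) ∧
      ∫ y, ‖y - p y‖ ^ 2 ∂(stdGaussian E) ≤ Fintype.card ι / (4 * c ^ 2) := by
  -- Chosen so that `√μ / 2 = μ c`, which cancels the uncontrolled trace of the inverse slack.
  set μ : ℝ := 1 / (4 * c ^ 2) with hμdef
  have hμ : 0 < μ := by positivity
  have hsqrt : √μ = 1 / (2 * c) := by
    rw [hμdef, show 1 / (4 * c ^ 2) = (1 / (2 * c)) ^ 2 by field_simp; norm_num]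
    exact Real.sqrt_sq (by positivity)
  choose p hp hpy using exists_add_barrierGrad_eq b hμ hc h𝒜
  have hlip := norm_sub_le_of_add_barrierGrad_eq b hμ.le h𝒜 hp hpy
  have hpL : LipschitzWith 1 p := LipschitzWith.of_dist_le_mul fun y y' => by
    simpa [dist_eq_norm] using hlip y y'
  have hdiff := differentiableAt_of_add_barrierGrad_eq b hμ h𝒜 hp hpy
  let g : κ → E → ℝ := fun i y => ⟪b i, y - p y⟫
  have hgd : ∀ i y, HasFDerivAt (g i)
      ((innerSL ℝ (b i)).comp (ContinuousLinearMap.id ℝ E - fderiv ℝ p y)) y := fun i y =>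
    (innerSL ℝ (b i)).hasFDerivAt.comp y ((hasFDerivAt_id y).sub (hdiff y).1.hasFDerivAt)
  have hgL : ∀ i, LipschitzWith 2 (g i) := by
    intro i
    refine LipschitzWith.of_dist_le_mul fun y y' => ?_
    have h1 : g i y - g i y' = ⟪b i, (y - y') - (p y - p y')⟫ := by
      simp only [g, inner_sub_right]; ring
    rw [Real.dist_eq, h1, dist_eq_norm]
    refine (abs_real_inner_le_norm _ _).trans ?_
    rw [b.norm_eq_one, one_mul]
    have := norm_sub_le (y - y') (p y - p y')
    have := hlip y y'
    simp only [NNReal.coe_ofNat]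
    linarith
  have hStein : ∀ i, ∫ y, ⟪b i, y⟫ * g i y ∂(stdGaussian E) =
      ∫ y, fderiv ℝ (g i) y (b i) ∂(stdGaussian E) := fun i =>
    integral_inner_mul_stdGaussian (fun y => (hgd i y).differentiableAt) (hgL i) (b i)
  have hint1 := fun i => integrable_of_lipschitzWith (hgL i) (b i)
  have hint2 := fun i => integrable_fderiv_of_lipschitzWith (hgL i) (b i)
  have hsq : Integrable (fun y => ‖y - p y‖ ^ 2) (stdGaussian E) := by
    have hb : Integrable (fun y : E => 8 * ‖y‖ ^ 2 + 2 * ‖p 0‖ ^ 2) (stdGaussian E) :=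
      (integrable_norm_sq_stdGaussian.const_mul 8).add (integrable_const _)
    refine hb.mono' ((continuous_id.sub hpL.continuous).norm.pow 2).aestronglyMeasurable
      (Filter.Eventually.of_forall fun y => ?_)
    rw [Real.norm_of_nonneg (by positivity)]
    have h1 : ‖y - p y‖ ≤ 2 * ‖y‖ + ‖p 0‖ := by
      have h2 := hlip y 0
      rw [sub_zero] at h2
      have h3 := norm_sub_le y (p y)
      have h4 := norm_sub_norm_le (p y) (p 0)
      linarith
    nlinarith [norm_nonneg (y - p y), sq_nonneg (2 * ‖y‖ - ‖p 0‖)]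
  refine ⟨p, hpL.continuous, hp, hsq, ?_⟩
  -- A pointwise bound in which, after integration, Stein's identity cancels the two sums.
  have hmain : ∀ y, ‖y - p y‖ ^ 2 ≤ ∑ i, ⟪b i, y⟫ * g i y +
      (Fintype.card ι / (4 * c ^ 2) - ∑ i, fderiv ℝ (g i) y (b i)) := by
    intro y
    have hG : y - p y = barrierGrad 𝒜 b μ c (p y) := by
      nth_rewrite 1 [← hpy y]
      abel
    have h1 : ∑ i, ⟪b i, y⟫ * g i y = ‖y - p y‖ ^ 2 + ⟪y - p y, p y⟫ := by
      have : ∑ i, ⟪b i, y⟫ * g i y = ⟪y, y - p y⟫ := by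
        rw [← b.sum_inner_mul_inner]
        exact Finset.sum_congr rfl fun i _ => by rw [real_inner_comm]
      rw [this, ← real_inner_self_eq_norm_sq, ← inner_add_right, sub_add_cancel, real_inner_comm]
    have h2 : ⟪y - p y, p y⟫ =
        μ * (c * (slack 𝒜 c (p y))⁻¹.trace - Fintype.card ι) := by
      rw [hG]
      exact inner_barrierGrad_self b μ (hp y)
    have h3 : ∑ i, fderiv ℝ (g i) y (b i) ≤ √μ * (slack 𝒜 c (p y))⁻¹.trace / 2 := by
      have h4 : ∀ i, fderiv ℝ (g i) y (b i) ≤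
          √μ * ((slack 𝒜 c (p y))⁻¹ * B i).trace / 2 := by
        intro i
        rw [(hgd i y).fderiv]
        have h5 := (hdiff y).2 (b i) (B i) (b.norm_eq_one i) (hsub i) (hadd i)
        simpa [inner_sub_right, real_inner_self_eq_norm_sq] using h5
      refine (Finset.sum_le_sum fun i _ => h4 i).trans ?_
      rw [← Finset.sum_div, ← Finset.mul_sum, ← trace_sum, ← Matrix.mul_sum]
      have h6 := trace_mul_le_trace_mul (hp y).inv.posSemidef hB
      rw [Matrix.mul_one] at h6
      gcongr
    have h7 : μ * (c * (slack 𝒜 c (p y))⁻¹.trace - Fintype.card ι) =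
        √μ * (slack 𝒜 c (p y))⁻¹.trace / 2 - Fintype.card ι / (4 * c ^ 2) := by
      rw [hsqrt, hμdef]
      field_simp
      ring
    linarith
  have hi1 : Integrable (fun y => ∑ i, ⟪b i, y⟫ * g i y) (stdGaussian E) :=
    integrable_finsetSum _ fun i _ => hint1 i
  have hi2 : Integrable (fun y => ∑ i, fderiv ℝ (g i) y (b i)) (stdGaussian E) :=
    integrable_finsetSum _ fun i _ => hint2 i
  have hi3 := (integrable_const (μ := stdGaussian E)
    ((Fintype.card ι : ℝ) / (4 * c ^ 2))).sub hi2
  refine (integral_mono hsq (hi1.add hi3) hmain).trans (le_of_eq ?_)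
  rw [integral_add' hi1 hi3, integral_sub' (integrable_const _) hi2,
    integral_finsetSum _ fun i _ => hint1 i, integral_finsetSum _ fun i _ => hint2 i,
    Finset.sum_congr rfl fun i _ => hStein i]
  simp

/-- If `card ι / (4 c²) ≤ r² / 2`, a standard Gaussian vector is within distance `r` of the
spectrahedron `𝒜 x ≺ c I` with probability at least one half. -/
theorem one_half_le_stdGaussian (b : OrthonormalBasis κ ℝ E) (hc : 0 < c)
    (h𝒜 : ∀ x, (𝒜 x).IsHermitian) {B : κ → Matrix ι ι ℝ}
    (hsub : ∀ i, (B i - 𝒜 (b i)).PosSemidef) (hadd : ∀ i, (B i + 𝒜 (b i)).PosSemidef)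
    (hB : (1 - ∑ i, B i).PosSemidef) {r : ℝ} (hr : 0 < r)
    (hcr : (Fintype.card ι : ℝ) / (4 * c ^ 2) ≤ r ^ 2 / 2) :
    1 / 2 ≤ stdGaussian E {y | ∃ x, (slack 𝒜 c x).PosDef ∧ dist y x ≤ r} := by
  obtain ⟨p, hpc, hp, hint, hle⟩ := exists_integral_norm_sq_sub_le b hc h𝒜 hsub hadd hB
  have hmark := mul_meas_ge_le_integral_of_nonneg
    (Filter.Eventually.of_forall fun y => by positivity) hint (r ^ 2)
  have hbad : (stdGaussian E).real {y | r ^ 2 ≤ ‖y - p y‖ ^ 2} ≤ 1 / 2 := by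
    have h1 : r ^ 2 * (stdGaussian E).real {y | r ^ 2 ≤ ‖y - p y‖ ^ 2} ≤ r ^ 2 * (1 / 2) := by
      linarith
    exact le_of_mul_le_mul_left h1 (by positivity)
  have hmeas : MeasurableSet {y | r ^ 2 ≤ ‖y - p y‖ ^ 2} :=
    (isClosed_le continuous_const ((continuous_id.sub hpc).norm.pow 2)).measurableSet
  have hgood : 1 / 2 ≤ (stdGaussian E).real {y | r ^ 2 ≤ ‖y - p y‖ ^ 2}ᶜ := by
    rw [probReal_compl_eq_one_sub hmeas]
    linarith
  have hsubset : {y | r ^ 2 ≤ ‖y - p y‖ ^ 2}ᶜ ⊆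
      {y | ∃ x, (slack 𝒜 c x).PosDef ∧ dist y x ≤ r} := by
    intro y hy
    refine ⟨p y, hp y, ?_⟩
    rw [dist_eq_norm]
    simp only [Set.mem_compl_iff, Set.mem_ofPred_eq, not_le] at hy
    exact (lt_of_pow_lt_pow_left₀ 2 hr.le hy).le
  refine le_trans ?_ (measure_mono hsubset)
  rw [← ENNReal.ofReal_le_ofReal_iff measureReal_nonneg, ofReal_measureReal] at hgood
  simpa using hgood

end GaussianDistance

/-! ### From the spectrahedron to the operator norm ball. -/

section OperatorNormBall

open Matrix

variable {m n : ℕ}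

lemma posSemidef_fromBlocks_diagonal {ι κ : Type*} [Fintype ι] [Fintype κ] {X : Matrix ι ι ℝ}
    {Y : Matrix κ κ ℝ} (hX : X.PosSemidef) (hY : Y.PosSemidef) :
    (fromBlocks X 0 0 Y).PosSemidef := by
  refine PosSemidef.of_dotProduct_mulVec_nonneg (hX.1.fromBlocks (by simp) hY.1) fun v => ?_
  rw [← Sum.elim_comp_inl_inr v, fromBlocks_mulVec]
  simp only [star_trivial, Sum.elim_comp_inl, Sum.elim_comp_inr, zero_mulVec, add_zero, zero_add,
    sumElim_dotProduct_sumElim]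
  exact add_nonneg (by simpa using hX.dotProduct_mulVec_nonneg (v ∘ Sum.inl))
    (by simpa using hY.dotProduct_mulVec_nonneg (v ∘ Sum.inr))

lemma fromBlocks_diagonal_sub {ι κ : Type*} (X X' : Matrix ι ι ℝ) (Y Y' : Matrix κ κ ℝ) :
    fromBlocks X 0 0 Y - fromBlocks X' 0 0 Y' = fromBlocks (X - X') 0 0 (Y - Y') := by
  ext (i | i) (j | j) <;> simp

lemma matAbs_eq {A : Matrix (Fin n) (Fin n) ℝ} (hA : A.IsHermitian) :
    matAbs hA = (hA.eigenvectorUnitary : Matrix (Fin n) (Fin n) ℝ) *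
      diagonal (fun i => |hA.eigenvalues i|) *
        (hA.eigenvectorUnitary : Matrix (Fin n) (Fin n) ℝ)ᴴ := by
  rw [matAbs, Matrix.IsHermitian.cfc, Unitary.conjStarAlgAut_apply]
  rfl

lemma matAbs_sub_posSemidef {A : Matrix (Fin n) (Fin n) ℝ} (hA : A.IsHermitian) :
    (matAbs hA - A).PosSemidef := by
  have h := hA.spectral_theorem
  rw [Unitary.conjStarAlgAut_apply] at h
  have e : matAbs hA - A = (hA.eigenvectorUnitary : Matrix (Fin n) (Fin n) ℝ) *
      diagonal (fun i => |hA.eigenvalues i| - hA.eigenvalues i) *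
        (hA.eigenvectorUnitary : Matrix (Fin n) (Fin n) ℝ)ᴴ := by
    rw [← diagonal_sub, Matrix.mul_sub, Matrix.sub_mul, ← matAbs_eq]
    congr 1
  rw [e]
  exact (PosSemidef.diagonal fun i => sub_nonneg.2 (le_abs_self _)).mul_mul_conjTranspose_same _

lemma matAbs_add_posSemidef {A : Matrix (Fin n) (Fin n) ℝ} (hA : A.IsHermitian) :
    (matAbs hA + A).PosSemidef := by
  have h := hA.spectral_theorem
  rw [Unitary.conjStarAlgAut_apply] at h
  have e : matAbs hA + A = (hA.eigenvectorUnitary : Matrix (Fin n) (Fin n) ℝ) *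
      diagonal (fun i => |hA.eigenvalues i| + hA.eigenvalues i) *
        (hA.eigenvectorUnitary : Matrix (Fin n) (Fin n) ℝ)ᴴ := by
    rw [← diagonal_add, Matrix.mul_add, Matrix.add_mul, ← matAbs_eq]
    congr 1
  rw [e]
  refine (PosSemidef.diagonal fun i => ?_).mul_mul_conjTranspose_same _
  have := neg_abs_le (hA.eigenvalues i)
  simp only [Pi.zero_apply]
  linarith

/-- With `P = c - M` and `Q = c + M`, which commute, `P Q P + Q P Q = 2c (c² - M²)`. Hence `M² ≤
c²`, which bounds `‖M v‖²`. -/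
lemma matOpNorm_le {M : Matrix (Fin n) (Fin n) ℝ} {c : ℝ} (hc : 0 < c)
    (hsub : (c • 1 - M).PosSemidef) (hadd : (c • 1 + M).PosSemidef) : matOpNorm M ≤ c := by
  have hM : M.IsHermitian := by
    have h := hadd.1.sub (show (c • (1 : Matrix (Fin n) (Fin n) ℝ)).IsHermitian by
      simp [IsHermitian])
    simpa using h
  have hsq : ((c ^ 2) • (1 : Matrix (Fin n) (Fin n) ℝ) - M * M).PosSemidef := by
    have h1 := hadd.mul_mul_conjTranspose_same (c • 1 - M)
    have h2 := hsub.mul_mul_conjTranspose_same (c • 1 + M)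
    rw [hsub.1.eq] at h1
    rw [hadd.1.eq] at h2
    have h3 := (h1.add h2).smul (show (0 : ℝ) ≤ 1 / (2 * c) by positivity)
    convert h3 using 1
    have e : (c • 1 - M) * (c • 1 + M) * (c • 1 - M) + (c • 1 + M) * (c • 1 - M) * (c • 1 + M) =
        (2 * c) • ((c ^ 2) • (1 : Matrix (Fin n) (Fin n) ℝ) - M * M) := by
      simp only [Matrix.mul_add, Matrix.mul_sub, Matrix.add_mul, Matrix.sub_mul, Matrix.smul_mul,
        Matrix.mul_smul, Matrix.mul_one, Matrix.one_mul, smul_sub, smul_add, smul_smul]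
      module
    rw [e, smul_smul, one_div_mul_cancel (by positivity), one_smul]
  refine ContinuousLinearMap.opNorm_le_bound _ hc.le fun v => ?_
  refine le_of_sq_le_sq ?_ (by positivity)
  have h := hsq.dotProduct_mulVec_nonneg v.ofLp
  rw [star_trivial, sub_mulVec, dotProduct_sub, smul_mulVec, one_mulVec, dotProduct_smul,
    ← mulVec_mulVec, dotProduct_mulVec, ← mulVec_transpose, ← conjTranspose_eq_transpose_of_trivial,
    hM.eq] at h
  rw [mul_pow, EuclideanSpace.real_norm_sq_eq, EuclideanSpace.real_norm_sq_eq]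
  simp only [ofLp_toEuclideanCLM]
  simp only [dotProduct, ← sq, smul_eq_mul] at h
  linarith

/-- The symmetrised pencil `x ↦ diag (∑ xᵢ Aᵢ, -∑ xᵢ Aᵢ)`. -/
noncomputable def blockPencil (A : Fin m → Matrix (Fin n) (Fin n) ℝ) :
    EuclideanSpace ℝ (Fin m) →ₗ[ℝ] Matrix (Fin n ⊕ Fin n) (Fin n ⊕ Fin n) ℝ where
  toFun x := fromBlocks (matComb A x) 0 0 (-matComb A x)
  map_add' x y := by
    simp [matComb, add_smul, Finset.sum_add_distrib, fromBlocks_add, add_comm]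
  map_smul' r x := by
    simp [matComb, smul_smul, Finset.smul_sum, fromBlocks_smul]

lemma blockPencil_apply (A : Fin m → Matrix (Fin n) (Fin n) ℝ) (x : EuclideanSpace ℝ (Fin m)) :
    blockPencil A x = fromBlocks (matComb A x) 0 0 (-matComb A x) := rfl

lemma matComb_isHermitian {A : Fin m → Matrix (Fin n) (Fin n) ℝ} (hA : ∀ i, (A i).IsHermitian)
    (x : Fin m → ℝ) : (matComb A x).IsHermitian := by
  simp only [matComb, IsHermitian, conjTranspose_sum, conjTranspose_smul, star_trivial]
  exact Finset.sum_congr rfl fun i _ => by rw [(hA i).eq]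

lemma matOpNorm_matComb_le {A : Fin m → Matrix (Fin n) (Fin n) ℝ} {c : ℝ} (hc : 0 < c)
    {x : EuclideanSpace ℝ (Fin m)} (hx : (slack (blockPencil A) c x).PosDef) :
    matOpNorm (matComb A x) ≤ c := by
  have e : slack (blockPencil A) c x =
      fromBlocks (c • 1 - matComb A x) 0 0 (c • 1 + matComb A x) := by
    simp [slack, blockPencil_apply, ← fromBlocks_one, fromBlocks_smul, fromBlocks_diagonal_sub]
  rw [e] at hx
  refine matOpNorm_le hc ?_ ?_
  · have := hx.posSemidef.submatrix Sum.inl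
    exact this
  · have := hx.posSemidef.submatrix Sum.inr
    exact this

lemma smul_mem_smul_body {A : Fin m → Matrix (Fin n) (Fin n) ℝ} {ε s : ℝ} (hs : 0 < s)
    {x : EuclideanSpace ℝ (Fin m)} (hx : matOpNorm (matComb A x) ≤ s * ε) :
    x ∈ s • body A ε := by
  rw [Set.mem_smul_set_iff_inv_smul_mem₀ hs.ne']
  have e : matComb A (s⁻¹ • x).ofLp = s⁻¹ • matComb A x := by
    simp [matComb, Finset.smul_sum, smul_smul]
  simp only [body, Set.mem_ofPred_eq, e, matOpNorm, map_smul, norm_smul]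
  rw [Real.norm_of_nonneg (by positivity), inv_mul_le_iff₀ hs]
  exact hx

/-- A Gaussian vector is within `r` of the body `{x | ‖∑ xᵢ Aᵢ‖ ≤ s ε}` with probability at least
one half as soon as `r² ≥ n / (s ε)²`. -/
theorem one_half_le_stdGaussian_body {A : Fin m → Matrix (Fin n) (Fin n) ℝ}
    (hA : ∀ i, (A i).IsHermitian) (hsum : ∑ i, matAbs (hA i) ≤ 1) {ε s r : ℝ} (hε : 0 < ε)
    (hs : 0 < s) (hr : 0 < r) (hsr : n / (s * ε) ^ 2 ≤ r ^ 2) :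
    1 / 2 ≤ ProbabilityTheory.stdGaussian (EuclideanSpace ℝ (Fin m))
      {y | ∃ x ∈ s • body A ε, dist y x ≤ r} := by
  have hc : 0 < s * ε := mul_pos hs hε
  have hbasis : ∀ i, blockPencil A (EuclideanSpace.basisFun (Fin m) ℝ i) =
      fromBlocks (A i) 0 0 (-A i) := by
    intro i
    have : matComb A (EuclideanSpace.basisFun (Fin m) ℝ i).ofLp = A i := by
      simp [matComb]
    rw [blockPencil_apply, this]
  have h := one_half_le_stdGaussian (𝒜 := blockPencil A) (c := s * ε) (r := r)
    (EuclideanSpace.basisFun (Fin m) ℝ) hc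
    (fun x => (matComb_isHermitian hA x).fromBlocks (by simp) (matComb_isHermitian hA x).neg)
    (B := fun i => fromBlocks (matAbs (hA i)) 0 0 (matAbs (hA i)))
    (fun i => by
      rw [hbasis, fromBlocks_diagonal_sub]
      simpa using posSemidef_fromBlocks_diagonal (matAbs_sub_posSemidef (hA i))
        (matAbs_add_posSemidef (hA i)))
    (fun i => by
      rw [hbasis, fromBlocks_add]
      simpa [← sub_eq_add_neg] using posSemidef_fromBlocks_diagonal (matAbs_add_posSemidef (hA i))
        (matAbs_sub_posSemidef (hA i)))
    (by
      have e : ∑ i, fromBlocks (matAbs (hA i)) 0 0 (matAbs (hA i)) =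
          fromBlocks (∑ i, matAbs (hA i)) 0 0 (∑ i, matAbs (hA i)) := by
        ext (i | i) (j | j) <;> simp [Matrix.sum_apply]
      rw [e, ← fromBlocks_one, fromBlocks_diagonal_sub]
      simpa using posSemidef_fromBlocks_diagonal (Matrix.le_iff.1 hsum) (Matrix.le_iff.1 hsum))
    hr
    (by
      -- The doubled size `2n` leaves exactly the factor `1 / 2` required by Markov's inequality.
      have : ((Fintype.card (Fin n ⊕ Fin n) : ℕ) : ℝ) / (4 * (s * ε) ^ 2) =
          n / (s * ε) ^ 2 / 2 := by
        rw [Fintype.card_sum, Fintype.card_fin]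
        push_cast
        field_simp
        ring
      rw [this]
      linarith)
  refine h.trans (MeasureTheory.measure_mono ?_)
  rintro y ⟨x, hx, hxy⟩
  exact ⟨x, smul_mem_smul_body hs (matOpNorm_matComb_le hc hx), hxy⟩

end OperatorNormBall

end SpectralGaussian

theorem theorem1 (m n : ℕ) (A : Fin m → Matrix (Fin n) (Fin n) ℝ)
    (hA : ∀ i, (A i).IsHermitian)
    (hsum : ∑ i, SpectralGaussian.matAbs (hA i) ≤ 1)
    (ε : ℝ) (hε₀ : 0 < ε) (hε₁ : ε < 1)
    (hm : (m : ℝ) = (n : ℝ) / ε ^ 2) (hm100 : 100 ≤ m)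
    (α : ℝ) (hα₀ : 0 < α) (hα₁ : α < 1) :
    1 / 2 ≤ ProbabilityTheory.stdGaussian (EuclideanSpace ℝ (Fin m))
        ((50 / α) • SpectralGaussian.body A ε
          + (α * √(m : ℝ)) • Metric.closedBall (0 : EuclideanSpace ℝ (Fin m)) 1) ∧
    1 / 2 ≤ ProbabilityTheory.stdGaussian (EuclideanSpace ℝ (Fin m))
        {y | Metric.infDist y ((50 / α) • SpectralGaussian.body A ε) ≤ α * √(m : ℝ)} := by
  have hmpos : (0 : ℝ) < m := by
    have : 0 < m := by omega
    exact_mod_cast this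
  have hr : 0 < α * √(m : ℝ) := mul_pos hα₀ (Real.sqrt_pos.2 hmpos)
  have hsr : (n : ℝ) / (50 / α * ε) ^ 2 ≤ (α * √(m : ℝ)) ^ 2 := by
    -- Since `n = m ε²`, the constant 50 leaves a spare factor of 2500; the constant 1 would give
    -- equality.
    have e : (n : ℝ) / (50 / α * ε) ^ 2 = α ^ 2 * m / 2500 := by
      rw [hm]
      field_simp
      norm_num
    rw [e, mul_pow, Real.sq_sqrt hmpos.le]
    have : 0 ≤ α ^ 2 * m := by positivity
    linarith
  have h := SpectralGaussian.one_half_le_stdGaussian_body hA hsum hε₀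
    (show 0 < 50 / α by positivity) hr hsr
  refine ⟨h.trans (MeasureTheory.measure_mono ?_), h.trans (MeasureTheory.measure_mono ?_)⟩
  · rintro y ⟨x, hx, hxy⟩
    refine Set.mem_add.2 ⟨x, hx, y - x, ?_, by abel⟩
    rw [smul_closedBall _ _ zero_le_one, smul_zero, mem_closedBall_zero_iff,
      Real.norm_of_nonneg hr.le, mul_one, ← dist_eq_norm]
    exact hxy
  · rintro y ⟨x, hx, hxy⟩
    exact (Metric.infDist_le_dist_of_mem hx).trans hxy
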